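/- Let $(\Omega,\Sigma,\mu)$ be a finite measure space. A Banach function space $X(\mu)$ is an ideal of $L^0(\mu)$ (for the $\mu$-a.e. order) containing $\chi_\Omega$, equipped with a complete norm such that $\|f\|_{X}\le\|g\|_{X}$ whenever $f,g\in X(\mu)$ and $|f|\le|g|$. It has the Fatou property if, for every increasing norm-bounded sequence $(f_n)_n$ in $X(\mu)$ that converges $\mu$-a.e. to a measurable function $f$, we have $f\in X(\mu)$. Let $\mathrm{Lip}_0(\mathbb R)$ be the space of Lipschitz functions $\varphi:\mathbb R\to\mathbb R$ with $\varphi(0)=0$, normed by the Lipschitz constant $\mathrm{Lip}(\varphi)$. Let $\mathcal M(X,Y)$ be the space of multiplication operators $M_g:X(\mu)\to Y(\mu)$, $f\mapsto gf$, identified with the functions $g$, with the operator norm. The Köthe–Bochner space $\mathcal M(X,Y)(\mu,\mathrm{Lip}_0(\mathbb R))$ consists of the strongly measurable functions $\Phi:\Omega\to\mathrm{Lip}_0(\mathbb R)$ (a.e. limits of simple functions in the norm of $\mathrm{Lip}_0(\mathbb R)$) with $\mathrm{Lip}(\Phi(\cdot))\in\mathcal M(X,Y)$, and $\|\Phi\|_{\mathcal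 M(X,Y)(\mu,\mathrm{Lip}_0(\mathbb R))}=\|\mathrm{Lip}(\Phi(\cdot))\|_{\mathcal M(X,Y)}$. For $\Phi:\Omega\to\mathrm{Lip}_0(\mathbb R)$ and $T:X(\mu)\to Y(\mu)$, write $T=T_\Phi$ if, for all $f\in X(\mu)$, $T(f)(w)=\Phi(w)(f(w))$ for $\mu$-a.e. $w$. The map $T$ is strongly lattice Lipschitz if $T=T_\Phi$ for some $\Phi\in\mathcal M(X,Y)(\mu,\mathrm{Lip}_0(\mathbb R))$. **Theorem.** Let $X(\mu)$ and $Y(\mu)$ be Banach function spaces such that $X(\mu)\subseteq Y(\mu)$ and $Y(\mu)$ has the Fatou property. For a map $T:X(\mu)\to Y(\mu)$ the following are equivalent. (i) $T$ is strongly lattice Lipschitz. (ii) There are a strongly measurable function $\Phi:\Omega\to\mathrm{Lip}_0(\mathbb R)$ with $T=T_\Phi$ and a sequence $(\Phi_n)_n$ of essentially bounded functions in $L^\infty(\mu,\mathrm{Lip}_0(\mathbb R))$ that converges $\mu$-a.e. to $\Phi$ (in the norm of $\mathrm{Lip}_0(\mathbb R)$) and satisfies $\sup_n\|\mathrm{Lip}(\Phi_n(\cdot))\|_{\mathcal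 M(X,Y)}<\infty$. Moreover, if these conditions hold, then every strongly measurable $\Phi$ with $T=T_\Phi$ belongs to $\mathcal M(X,Y)(\mu,\mathrm{Lip}_0(\mathbb R))$, and the sequence $(\Phi_n)_n$ in (ii) can be chosen so that $$\sup_n\|\Phi_n\|_{\mathcal M(X,Y)(\mu,\mathrm{Lip}_0(\mathbb R))}=\|\Phi\|_{\mathcal M(X,Y)(\mu,\mathrm{Lip}_0(\mathbb R))}.$$ -/

import Mathlib

open MeasureTheory Filter Topology Set
open scoped ENNReal

noncomputable section

/-- The vector space of Lipschitz functions `φ : ℝ → ℝ` with `φ 0 = 0`. -/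
def lipZeroSubmodule : Submodule ℝ (ℝ → ℝ) where
  carrier := {φ | φ 0 = 0 ∧ ∃ K : ℝ, ∀ x y, |φ x - φ y| ≤ K * |x - y|}
  zero_mem' := ⟨rfl, 0, fun x y => by simp⟩
  add_mem' := by
    rintro φ ψ ⟨hφ, K, hK⟩ ⟨hψ, L, hL⟩
    refine ⟨by simp [hφ, hψ], K + L, fun x y => ?_⟩
    calc |(φ + ψ) x - (φ + ψ) y| = |(φ x - φ y) + (ψ x - ψ y)| := by
          simp only [Pi.add_apply]; congr 1; ring
      _ ≤ |φ x - φ y| + |ψ x - ψ y| := abs_add_le _ _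
      _ ≤ (K + L) * |x - y| := by linarith [hK x y, hL x y]
  smul_mem' := by
    rintro c φ ⟨hφ, K, hK⟩
    refine ⟨by simp [hφ], |c| * K, fun x y => ?_⟩
    calc |(c • φ) x - (c • φ) y| = |c| * |φ x - φ y| := by
          rw [← abs_mul]; simp only [Pi.smul_apply, smul_eq_mul]; congr 1; ring
      _ ≤ |c| * (K * |x - y|) := mul_le_mul_of_nonneg_left (hK x y) (abs_nonneg c)
      _ = |c| * K * |x - y| := by ring

/-- The space `Lip₀(ℝ)`. It is a type of its own, so that its topology is the one of the
Lipschitz norm below and not the topology of pointwise convergence. -/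
def LipZero : Type := lipZeroSubmodule

namespace LipZero

instance : AddCommGroup LipZero := inferInstanceAs (AddCommGroup lipZeroSubmodule)

instance : Module ℝ LipZero := inferInstanceAs (Module ℝ lipZeroSubmodule)

instance : CoeFun LipZero (fun _ => ℝ → ℝ) := ⟨fun φ => φ.1⟩

@[ext] theorem ext {φ ψ : LipZero} (h : ∀ x, φ x = ψ x) : φ = ψ := Subtype.ext (funext h)

@[simp] theorem zero_apply (x : ℝ) : (0 : LipZero) x = 0 := rfl

@[simp] theorem add_apply (φ ψ : LipZero) (x : ℝ) : (φ + ψ) x = φ x + ψ x := rfl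

@[simp] theorem smul_apply (c : ℝ) (φ : LipZero) (x : ℝ) : (c • φ) x = c * φ x := rfl

@[simp] theorem map_zero (φ : LipZero) : φ 0 = 0 := φ.2.1

/-- The Lipschitz constant `Lip(φ)`: the least `K ≥ 0` with `|φ x - φ y| ≤ K |x - y|` for all
`x, y`. -/
def lip (φ : LipZero) : ℝ := sInf {K : ℝ | 0 ≤ K ∧ ∀ x y, |φ x - φ y| ≤ K * |x - y|}

theorem lip_nonneg (φ : LipZero) : 0 ≤ φ.lip := Real.sInf_nonneg fun _ h => h.1

theorem lip_le {φ : LipZero} {K : ℝ} (hK : 0 ≤ K) (h : ∀ x y, |φ x - φ y| ≤ K * |x - y|) :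
    φ.lip ≤ K := csInf_le ⟨0, fun _ h => h.1⟩ ⟨hK, h⟩

theorem abs_sub_le (φ : LipZero) (x y : ℝ) : |φ x - φ y| ≤ φ.lip * |x - y| := by
  rcases eq_or_ne x y with rfl | hxy
  · simp
  have hpos : 0 < |x - y| := abs_pos.2 (sub_ne_zero.2 hxy)
  rw [← div_le_iff₀ hpos]
  obtain ⟨K, hK⟩ := φ.2.2
  refine le_csInf ⟨max K 0, le_max_right _ _, fun a b => (hK a b).trans ?_⟩ ?_
  · exact mul_le_mul_of_nonneg_right (le_max_left _ _) (abs_nonneg _)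
  · rintro L ⟨-, hL⟩
    rw [div_le_iff₀ hpos]
    exact hL x y

instance : Norm LipZero := ⟨lip⟩

theorem norm_eq_lip (φ : LipZero) : ‖φ‖ = φ.lip := rfl

theorem lip_smul_le (c : ℝ) (φ : LipZero) : (c • φ).lip ≤ |c| * φ.lip := by
  refine lip_le (mul_nonneg (abs_nonneg c) φ.lip_nonneg) fun x y => ?_
  rw [smul_apply, smul_apply, ← mul_sub, abs_mul, mul_assoc]
  exact mul_le_mul_of_nonneg_left (φ.abs_sub_le x y) (abs_nonneg c)

theorem normedSpaceCore : NormedSpace.Core ℝ LipZero where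
  norm_nonneg := lip_nonneg
  norm_smul c φ := by
    refine le_antisymm (lip_smul_le c φ) ?_
    rcases eq_or_ne c 0 with rfl | hc
    · rw [norm_zero, zero_mul]
      exact lip_nonneg _
    · have h := lip_smul_le c⁻¹ (c • φ)
      rw [inv_smul_smul₀ hc, abs_inv] at h
      exact (le_inv_mul_iff₀ (abs_pos.2 hc)).1 h
  norm_triangle φ ψ := by
    refine lip_le (add_nonneg φ.lip_nonneg ψ.lip_nonneg) fun x y => ?_
    have h := abs_add_le (φ x - φ y) (ψ x - ψ y)
    have e : (φ + ψ) x - (φ + ψ) y = (φ x - φ y) + (ψ x - ψ y) := by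
      simp only [add_apply]; ring
    rw [e, norm_eq_lip, norm_eq_lip]
    linarith [φ.abs_sub_le x y, ψ.abs_sub_le x y]
  norm_eq_zero_iff φ := by
    constructor
    · intro h
      ext x
      have h1 := φ.abs_sub_le x 0
      have h2 : φ.lip = 0 := h
      rw [h2, zero_mul, map_zero, sub_zero] at h1
      exact abs_nonpos_iff.1 h1
    · rintro rfl
      exact le_antisymm (lip_le le_rfl fun x y => by simp) (lip_nonneg _)

instance : NormedAddCommGroup LipZero := NormedAddCommGroup.ofCore normedSpaceCore

instance : NormedSpace ℝ LipZero := NormedSpace.ofCore normedSpaceCore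

end LipZero

/-- A Banach function space over `μ`: an ideal of `L⁰(μ)` (for the `μ`-a.e. order) that contains
the constant function `1`, with a complete lattice norm. -/
structure BanachFunctionSpace {Ω : Type*} [MeasurableSpace Ω] (μ : Measure Ω) where
  /-- The underlying vector subspace of `L⁰(μ)`. -/
  toSubmodule : Submodule ℝ (Ω →ₘ[μ] ℝ)
  /-- The norm. -/
  normFun : toSubmodule → ℝ
  normFun_nonneg : ∀ f, 0 ≤ normFun f
  normFun_smul : ∀ (c : ℝ) f, normFun (c • f) = |c| * normFun f
  normFun_add_le : ∀ f g, normFun (f + g) ≤ normFun f + normFun g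
  normFun_eq_zero_iff : ∀ f, normFun f = 0 ↔ f = 0
  /-- Every Cauchy sequence converges. -/
  complete : ∀ u : ℕ → toSubmodule,
    (∀ ε > 0, ∃ N, ∀ m ≥ N, ∀ n ≥ N, normFun (u m - u n) < ε) →
      ∃ f, Tendsto (fun n => normFun (u n - f)) atTop (𝓝 0)
  /-- The ideal property. -/
  ideal : ∀ f g : Ω →ₘ[μ] ℝ, |f| ≤ |g| → g ∈ toSubmodule → f ∈ toSubmodule
  /-- The norm is a lattice norm. -/
  normFun_mono : ∀ f g : toSubmodule,
    |(f : Ω →ₘ[μ] ℝ)| ≤ |(g : Ω →ₘ[μ] ℝ)| → normFun f ≤ normFun g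
  one_mem : (1 : Ω →ₘ[μ] ℝ) ∈ toSubmodule

namespace BanachFunctionSpace

variable {Ω : Type*} [MeasurableSpace Ω] {μ : Measure Ω}

/-- The elements of `X(μ)`, as a type that carries the norm of `X(μ)`. -/
def Elem (X : BanachFunctionSpace μ) : Type _ := X.toSubmodule

instance : CoeSort (BanachFunctionSpace μ) (Type _) := ⟨Elem⟩

instance (X : BanachFunctionSpace μ) : AddCommGroup X :=
  inferInstanceAs (AddCommGroup X.toSubmodule)

instance (X : BanachFunctionSpace μ) : Module ℝ X :=
  inferInstanceAs (Module ℝ X.toSubmodule)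

/-- The `μ`-a.e. class of functions that an element of `X(μ)` is. -/
def Elem.toAEEqFun {X : BanachFunctionSpace μ} (f : X) : Ω →ₘ[μ] ℝ := f.1

instance (X : BanachFunctionSpace μ) : CoeOut X (Ω →ₘ[μ] ℝ) := ⟨Elem.toAEEqFun⟩

instance (X : BanachFunctionSpace μ) : Norm X := ⟨X.normFun⟩

theorem normedSpaceCore (X : BanachFunctionSpace μ) : NormedSpace.Core ℝ X where
  norm_nonneg := X.normFun_nonneg
  norm_smul := X.normFun_smul
  norm_triangle := X.normFun_add_le
  norm_eq_zero_iff := X.normFun_eq_zero_iff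

instance (X : BanachFunctionSpace μ) : NormedAddCommGroup X :=
  NormedAddCommGroup.ofCore X.normedSpaceCore

instance (X : BanachFunctionSpace μ) : NormedSpace ℝ X :=
  NormedSpace.ofCore X.normedSpaceCore

/-- The Fatou property: the `μ`-a.e. limit of an increasing norm bounded sequence of elements of
`X(μ)` belongs to `X(μ)`. -/
def HasFatouProperty (X : BanachFunctionSpace μ) : Prop :=
  ∀ (f : ℕ → X) (g : Ω →ₘ[μ] ℝ),
    Monotone (fun n => (f n : Ω →ₘ[μ] ℝ)) →
    (∃ C : ℝ, ∀ n, ‖f n‖ ≤ C) →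
    (∀ᵐ w ∂μ, Tendsto (fun n => (f n : Ω →ₘ[μ] ℝ) w) atTop (𝓝 (g w))) →
    g ∈ X.toSubmodule

/-- The space `𝓜(X,Y)` of multiplication operators, each identified with its symbol: the
functions `g ∈ L⁰(μ)` for which `f ↦ g f` is a continuous linear operator `M_g : X(μ) → Y(μ)`. -/
def multipliers (X Y : BanachFunctionSpace μ) : Submodule ℝ (Ω →ₘ[μ] ℝ) where
  carrier := {g | ∃ M : X →L[ℝ] Y, ∀ f : X, (M f : Ω →ₘ[μ] ℝ) = g * (f : Ω →ₘ[μ] ℝ)}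
  zero_mem' := ⟨0, fun f => by
    change (0 : Ω →ₘ[μ] ℝ) = 0 * f.toAEEqFun
    induction f.toAEEqFun using AEEqFun.induction_on with
    | _ f hf =>
      rw [AEEqFun.zero_def, AEEqFun.mk_mul_mk]
      simp only [AEEqFun.mk_eq_mk]
      exact .of_forall fun w => (zero_mul (f w)).symm⟩
  add_mem' := by
    rintro g h ⟨M, hM⟩ ⟨N, hN⟩
    refine ⟨M + N, fun f => ?_⟩
    change (M f).toAEEqFun + (N f).toAEEqFun = _
    rw [hM f, hN f]
    apply AEEqFun.ext
    filter_upwards [AEEqFun.coeFn_add (g * f.toAEEqFun) (h * f.toAEEqFun),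
      AEEqFun.coeFn_mul g f.toAEEqFun, AEEqFun.coeFn_mul h f.toAEEqFun,
      AEEqFun.coeFn_mul (g + h) f.toAEEqFun, AEEqFun.coeFn_add g h] with w h1 h2 h3 h4 h5
    simp only [h1, h2, h3, h4, h5, Pi.add_apply, Pi.mul_apply, add_mul]
  smul_mem' := by
    rintro c g ⟨M, hM⟩
    refine ⟨c • M, fun f => ?_⟩
    change c • (M f).toAEEqFun = _
    rw [hM f]
    apply AEEqFun.ext
    filter_upwards [AEEqFun.coeFn_smul c (g * f.toAEEqFun), AEEqFun.coeFn_mul g f.toAEEqFun,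
      AEEqFun.coeFn_mul (c • g) f.toAEEqFun, AEEqFun.coeFn_smul c g] with w h1 h2 h3 h4
    simp only [h1, h2, h3, h4, Pi.smul_apply, Pi.mul_apply, smul_eq_mul, mul_assoc]

/-- The multiplication operator `M_g : X(μ) → Y(μ)`, `f ↦ g f`. -/
def mulOperator {X Y : BanachFunctionSpace μ} (g : multipliers X Y) : X →L[ℝ] Y :=
  g.2.choose

theorem mulOperator_apply {X Y : BanachFunctionSpace μ} (g : multipliers X Y) (f : X) :
    (mulOperator g f : Ω →ₘ[μ] ℝ) = (g : Ω →ₘ[μ] ℝ) * (f : Ω →ₘ[μ] ℝ) :=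
  g.2.choose_spec f

/-- The norm of `𝓜(X,Y)`: the operator norm of `M_g`. -/
def multiplierNorm {X Y : BanachFunctionSpace μ} (g : multipliers X Y) : ℝ :=
  ‖mulOperator g‖

/-- `Φ` belongs to the Köthe–Bochner space `𝓜(X,Y)(μ, E)`: it is strongly measurable and
`w ↦ ‖Φ(w)‖` belongs to `𝓜(X,Y)`. (`AEStronglyMeasurable` means a.e. limit of simple
functions.) -/
def MemKotheBochner (X Y : BanachFunctionSpace μ) {E : Type*} [NormedAddCommGroup E]
    (Φ : Ω → E) : Prop :=
  ∃ hΦ : AEStronglyMeasurable Φ μ, AEEqFun.mk (fun w => ‖Φ w‖) hΦ.norm ∈ multipliers X Y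

/-- The norm of `𝓜(X,Y)(μ, E)`: the norm of `w ↦ ‖Φ(w)‖` in `𝓜(X,Y)`. -/
def kotheBochnerNorm {X Y : BanachFunctionSpace μ} {E : Type*} [NormedAddCommGroup E]
    {Φ : Ω → E} (hΦ : MemKotheBochner X Y Φ) : ℝ :=
  multiplierNorm (⟨AEEqFun.mk (fun w => ‖Φ w‖) hΦ.1.norm, hΦ.2⟩ : multipliers X Y)

/-- `T = T_Φ`, where `T_Φ` is the superposition operator `T_Φ(f)(w) = Φ(w)(f(w))`. -/
def IsSuperposition {X Y : BanachFunctionSpace μ} (T : X → Y) (Φ : Ω → LipZero) : Prop :=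
  ∀ f : X, ∀ᵐ w ∂μ, (T f : Ω →ₘ[μ] ℝ) w = Φ w ((f : Ω →ₘ[μ] ℝ) w)

/-- `T` is strongly lattice Lipschitz: `T = T_Φ` for some `Φ ∈ 𝓜(X,Y)(μ, Lip₀(ℝ))`. -/
def StronglyLatticeLipschitz {X Y : BanachFunctionSpace μ} (T : X → Y) : Prop :=
  ∃ Φ : Ω → LipZero, MemKotheBochner X Y Φ ∧ IsSuperposition T Φ

end BanachFunctionSpace

end

/-! Both directions rest on domination. If `Φ` lies in the Köthe–Bochner space, its truncations to
the sets where `‖Φ‖ ≤ n` are essentially bounded, converge to `Φ`, and have norms at most that of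
`Φ`, because `multipliers X Y` is an ideal with a monotone norm.

Conversely, let `Φs n → Φ` a.e. with norms at most `C`. For `f` in `X`, the tail infima of `‖Φs n‖`,
times `|f|`, increase to `‖Φ‖ |f|` with norms at most `C ‖f‖`, so the Fatou property puts `‖Φ‖ f` in
`Y` (`MemKotheBochner.of_tendsto`). This property gives membership without a norm estimate;
continuity of the multiplication operator comes instead from completeness of `X`
(`exists_norm_mulLinearMap_le`).

All representing functions agree a.e. (`IsSuperposition.ae_eq`), so membership passes from one to
every other. The exact supremum is reached by putting a constant function in front of the
truncations; constants are multipliers because `X ⊆ Y`. -/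

namespace BanachFunctionSpace

variable {Ω : Type*} [MeasurableSpace Ω] {μ : Measure Ω}

/-! ### Order and convergence in a Banach function space -/

theorem aeEqFun_abs_le_abs_iff {f g : Ω →ₘ[μ] ℝ} :
    |f| ≤ |g| ↔ ∀ᵐ w ∂μ, |f w| ≤ |g w| := by
  rw [← AEEqFun.coeFn_le]
  constructor
  · intro h
    filter_upwards [h, AEEqFun.coeFn_abs f, AEEqFun.coeFn_abs g] with w h hf hg
    rwa [hf, hg] at h
  · intro h
    filter_upwards [h, AEEqFun.coeFn_abs f, AEEqFun.coeFn_abs g] with w h hf hg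
    rwa [hf, hg]

theorem mem_of_ae_abs_le (X : BanachFunctionSpace μ) {f g : Ω →ₘ[μ] ℝ}
    (hg : g ∈ X.toSubmodule) (h : ∀ᵐ w ∂μ, |f w| ≤ |g w|) : f ∈ X.toSubmodule :=
  X.ideal f g (aeEqFun_abs_le_abs_iff.2 h) hg

theorem Elem.norm_le_norm {X : BanachFunctionSpace μ} {f g : X}
    (h : ∀ᵐ w ∂μ, |f.toAEEqFun w| ≤ |g.toAEEqFun w|) : ‖f‖ ≤ ‖g‖ :=
  X.normFun_mono f g (aeEqFun_abs_le_abs_iff.2 h)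

theorem Elem.toAEEqFun_injective {X : BanachFunctionSpace μ} :
    Function.Injective (Elem.toAEEqFun : X → Ω →ₘ[μ] ℝ) := Subtype.val_injective

theorem Elem.coeFn_add {X : BanachFunctionSpace μ} (f g : X) :
    ∀ᵐ w ∂μ, (f + g).toAEEqFun w = f.toAEEqFun w + g.toAEEqFun w :=
  AEEqFun.coeFn_add f.toAEEqFun g.toAEEqFun

theorem Elem.coeFn_sub {X : BanachFunctionSpace μ} (f g : X) :
    ∀ᵐ w ∂μ, (f - g).toAEEqFun w = f.toAEEqFun w - g.toAEEqFun w :=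
  AEEqFun.coeFn_sub f.toAEEqFun g.toAEEqFun

theorem Elem.coeFn_smul {X : BanachFunctionSpace μ} (c : ℝ) (f : X) :
    ∀ᵐ w ∂μ, (c • f).toAEEqFun w = c * f.toAEEqFun w :=
  AEEqFun.coeFn_smul c f.toAEEqFun

theorem Elem.coeFn_zero {X : BanachFunctionSpace μ} :
    ∀ᵐ w ∂μ, (0 : X).toAEEqFun w = 0 :=
  AEEqFun.coeFn_zero

instance (X : BanachFunctionSpace μ) : CompleteSpace X := by
  refine Metric.complete_of_cauchySeq_tendsto fun u hu => ?_
  obtain ⟨f, hf⟩ := X.complete u fun ε hε => by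
    obtain ⟨N, hN⟩ := Metric.cauchySeq_iff.1 hu ε hε
    refine ⟨N, fun m hm n hn => ?_⟩
    have h := hN m hm n hn
    rw [dist_eq_norm] at h
    exact h
  exact ⟨f, tendsto_iff_norm_sub_tendsto_zero.2 hf⟩

/-- The positive cone of a Banach function space is closed. -/
theorem Elem.ae_nonneg_of_tendsto {X : BanachFunctionSpace μ} {ι : Type*} {l : Filter ι} [l.NeBot]
    {u : ι → X} {f : X} (hu : ∀ᶠ i in l, ∀ᵐ w ∂μ, 0 ≤ (u i).toAEEqFun w)
    (hf : Tendsto u l (𝓝 f)) : ∀ᵐ w ∂μ, 0 ≤ f.toAEEqFun w := by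
  have hinf : ∀ᵐ w ∂μ, (f.toAEEqFun ⊓ 0) w = min (f.toAEEqFun w) 0 := by
    filter_upwards [AEEqFun.coeFn_inf f.toAEEqFun 0, AEEqFun.coeFn_zero (μ := μ) (β := ℝ)]
      with w h1 h2
    rw [h1, h2]
    rfl
  have hmem : f.toAEEqFun ⊓ 0 ∈ X.toSubmodule := by
    refine X.mem_of_ae_abs_le f.2 ?_
    filter_upwards [hinf] with w h1
    rw [h1]
    rcases le_total (f.toAEEqFun w) 0 with h | h
    · rw [min_eq_left h]; exact le_rfl
    · rw [min_eq_right h, abs_zero]; exact abs_nonneg _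
  let v : X := ⟨f.toAEEqFun ⊓ 0, hmem⟩
  -- Where `f < 0 ≤ u i`, the distance from `u i` to `f` is at least `|f|`; hence the negative part
  -- of `f` is dominated by `|u i - f|`.
  have hle : ∀ᶠ i in l, ‖v‖ ≤ ‖u i - f‖ := by
    filter_upwards [hu] with i hi
    refine Elem.norm_le_norm ?_
    filter_upwards [hinf, hi, Elem.coeFn_sub (u i) f] with w h1 h2 h3
    rw [h3, show v.toAEEqFun w = min (f.toAEEqFun w) 0 from h1]
    rcases le_total (f.toAEEqFun w) 0 with h | h
    · rw [min_eq_left h, abs_of_nonpos h]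
      exact le_trans (by linarith) (le_abs_self _)
    · rw [min_eq_right h, abs_zero]; exact abs_nonneg _
  have hv : v = 0 := norm_le_zero_iff.1
    (ge_of_tendsto (tendsto_iff_norm_sub_tendsto_zero.1 hf) hle)
  have hv0 : f.toAEEqFun ⊓ 0 = 0 := congrArg Elem.toAEEqFun hv
  filter_upwards [hinf, AEEqFun.coeFn_zero (μ := μ) (β := ℝ)] with w h1 h2
  rw [hv0, h2] at h1
  exact min_eq_right_iff.1 h1.symm

/-- Partial sums containing `u n` exceed it by a nonnegative element, and the positive cone is
closed. -/
theorem Elem.ae_le_of_hasSum {X : BanachFunctionSpace μ} {u : ℕ → X} {s : X}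
    (hu : ∀ n, ∀ᵐ w ∂μ, 0 ≤ (u n).toAEEqFun w) (hs : HasSum u s) (n : ℕ) :
    ∀ᵐ w ∂μ, (u n).toAEEqFun w ≤ s.toAEEqFun w := by
  have hlim : Tendsto (fun k => ∑ i ∈ Finset.range k, u i - u n) atTop (𝓝 (s - u n)) :=
    hs.tendsto_sum_nat.sub_const _
  have hpos : ∀ᶠ k in atTop,
      ∀ᵐ w ∂μ, 0 ≤ (∑ i ∈ Finset.range k, u i - u n : X).toAEEqFun w := by
    filter_upwards [eventually_gt_atTop n] with k hk
    rw [← Finset.sum_erase_eq_sub (Finset.mem_range.2 hk)]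
    refine Finset.sum_induction u (fun f : X => ∀ᵐ w ∂μ, 0 ≤ f.toAEEqFun w) ?_ ?_ fun i _ => hu i
    · intro f g hf hg
      filter_upwards [hf, hg, Elem.coeFn_add f g] with w h1 h2 h3
      rw [h3]
      exact add_nonneg h1 h2
    · filter_upwards [Elem.coeFn_zero (X := X)] with w h
      rw [h]
  filter_upwards [Elem.ae_nonneg_of_tendsto hpos hlim, Elem.coeFn_sub s (u n)] with w h1 h2
  rw [h2] at h1
  exact sub_nonneg.1 h1

/-! ### Multipliers and automatic continuity -/

/-- Multiplication by `g` as a linear map, if it maps `X(μ)` into `Y(μ)`. -/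
noncomputable def mulLinearMap {X Y : BanachFunctionSpace μ} (g : Ω →ₘ[μ] ℝ)
    (hg : ∀ f : X, g * f.toAEEqFun ∈ Y.toSubmodule) : X →ₗ[ℝ] Y where
  toFun f := ⟨g * f.toAEEqFun, hg f⟩
  map_add' f h := by
    apply Elem.toAEEqFun_injective
    change g * (f.toAEEqFun + h.toAEEqFun) = g * f.toAEEqFun + g * h.toAEEqFun
    apply AEEqFun.ext
    filter_upwards [AEEqFun.coeFn_add (g * f.toAEEqFun) (g * h.toAEEqFun),
      AEEqFun.coeFn_mul g f.toAEEqFun, AEEqFun.coeFn_mul g h.toAEEqFun,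
      AEEqFun.coeFn_mul g (f.toAEEqFun + h.toAEEqFun),
      AEEqFun.coeFn_add f.toAEEqFun h.toAEEqFun] with w h1 h2 h3 h4 h5
    simp only [h1, h2, h3, h4, h5, Pi.add_apply, Pi.mul_apply, mul_add]
  map_smul' c f := by
    apply Elem.toAEEqFun_injective
    change g * (c • f.toAEEqFun) = c • (g * f.toAEEqFun)
    apply AEEqFun.ext
    filter_upwards [AEEqFun.coeFn_smul c (g * f.toAEEqFun), AEEqFun.coeFn_mul g f.toAEEqFun,
      AEEqFun.coeFn_mul g (c • f.toAEEqFun), AEEqFun.coeFn_smul c f.toAEEqFun] with w h1 h2 h3 h4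
    simp only [h1, h2, h3, h4, Pi.smul_apply, Pi.mul_apply, smul_eq_mul, mul_left_comm]

theorem coeFn_mulLinearMap {X Y : BanachFunctionSpace μ} (g : Ω →ₘ[μ] ℝ)
    (hg : ∀ f : X, g * f.toAEEqFun ∈ Y.toSubmodule) (f : X) :
    ∀ᵐ w ∂μ, (mulLinearMap g hg f).toAEEqFun w = g w * f.toAEEqFun w :=
  AEEqFun.coeFn_mul g f.toAEEqFun

/-- The absolute value of an element of a Banach function space. -/
theorem Elem.exists_abs {X : BanachFunctionSpace μ} (f : X) :
    ∃ u : X, ∀ᵐ w ∂μ, u.toAEEqFun w = |f.toAEEqFun w| := by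
  have h := AEEqFun.coeFn_abs f.toAEEqFun
  refine ⟨⟨|f.toAEEqFun|, X.mem_of_ae_abs_le f.2 ?_⟩, h⟩
  filter_upwards [h] with w hw
  rw [hw, abs_abs]
  exact le_rfl

/-- Otherwise there are `u n ≥ 0` with `‖u n‖ ≤ 2⁻ⁿ` and `‖g u n‖ > n`. Their sum exists and
dominates each `u n`, so its image under multiplication by `g` has norm greater than every `n`. -/
theorem exists_norm_mulLinearMap_le {X Y : BanachFunctionSpace μ} (g : Ω →ₘ[μ] ℝ)
    (hg : ∀ f : X, g * f.toAEEqFun ∈ Y.toSubmodule) :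
    ∃ C : ℝ, ∀ f : X, ‖mulLinearMap g hg f‖ ≤ C * ‖f‖ := by
  by_contra! hcon
  have key : ∀ n : ℕ, ∃ u : X, (∀ᵐ w ∂μ, 0 ≤ u.toAEEqFun w) ∧ ‖u‖ ≤ (1 / 2 : ℝ) ^ n ∧
      (n : ℝ) < ‖mulLinearMap g hg u‖ := by
    intro n
    -- The factor `2 ^ n` is spent on normalizing `|f|` to norm at most `2⁻ⁿ`, which leaves `n`.
    obtain ⟨f, hf⟩ := hcon (n * 2 ^ n)
    obtain ⟨v, hv⟩ := f.exists_abs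
    have hf0 : 0 < ‖f‖ := by
      rw [norm_pos_iff]
      rintro rfl
      simp at hf
    have hvf : ‖v‖ ≤ ‖f‖ := Elem.norm_le_norm <| by
      filter_upwards [hv] with w hw
      rw [hw, abs_abs]
    have hLv : ‖mulLinearMap g hg f‖ ≤ ‖mulLinearMap g hg v‖ := Elem.norm_le_norm <| by
      filter_upwards [hv, coeFn_mulLinearMap g hg f, coeFn_mulLinearMap g hg v] with w h1 h2 h3
      rw [h2, h3, h1, abs_mul, abs_mul, abs_abs]
    have hc : 0 < (2 ^ n * ‖f‖)⁻¹ := by positivity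
    refine ⟨(2 ^ n * ‖f‖)⁻¹ • v, ?_, ?_, ?_⟩
    · filter_upwards [hv, Elem.coeFn_smul (2 ^ n * ‖f‖)⁻¹ v] with w h1 h2
      rw [h2, h1]
      positivity
    · rw [norm_smul, Real.norm_of_nonneg hc.le, inv_mul_le_iff₀ (by positivity), one_div, inv_pow,
        mul_right_comm, mul_inv_cancel₀ (by positivity), one_mul]
      exact hvf
    · rw [map_smul, norm_smul, Real.norm_of_nonneg hc.le, lt_inv_mul_iff₀ (by positivity)]
      calc 2 ^ n * ‖f‖ * (n : ℝ) = n * 2 ^ n * ‖f‖ := by ring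
        _ < _ := hf.trans_le hLv
  choose u hu0 hu1 hu2 using key
  have hs : Summable u := Summable.of_norm_bounded summable_geometric_two hu1
  obtain ⟨n, hn⟩ := exists_nat_gt ‖mulLinearMap g hg (∑' n, u n)‖
  refine lt_irrefl _ ((hn.trans (hu2 n)).trans_le (Elem.norm_le_norm ?_))
  filter_upwards [hu0 n, Elem.ae_le_of_hasSum hu0 hs.hasSum n, coeFn_mulLinearMap g hg (u n),
    coeFn_mulLinearMap g hg (∑' n, u n)] with w h1 h2 h3 h4
  rw [h3, h4, abs_mul, abs_mul]
  exact mul_le_mul_of_nonneg_left (abs_le_abs_of_nonneg h1 h2) (abs_nonneg _)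

/-- A function that multiplies `X(μ)` into `Y(μ)` is a multiplier: continuity is automatic. -/
theorem mem_multipliers_of_forall_mul_mem {X Y : BanachFunctionSpace μ} {g : Ω →ₘ[μ] ℝ}
    (hg : ∀ f : X, g * f.toAEEqFun ∈ Y.toSubmodule) : g ∈ multipliers X Y :=
  ⟨(mulLinearMap g hg).mkContinuousOfExistsBound (exists_norm_mulLinearMap_le g hg),
    fun _ => rfl⟩

theorem coeFn_mulOperator {X Y : BanachFunctionSpace μ} (g : multipliers X Y) (f : X) :
    ∀ᵐ w ∂μ, (mulOperator g f).toAEEqFun w = (g : Ω →ₘ[μ] ℝ) w * f.toAEEqFun w := by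
  rw [show (mulOperator g f).toAEEqFun = _ from mulOperator_apply g f]
  exact AEEqFun.coeFn_mul _ _

theorem mem_multipliers_of_ae_abs_le {X Y : BanachFunctionSpace μ} {g h : Ω →ₘ[μ] ℝ}
    (hh : h ∈ multipliers X Y) (hgh : ∀ᵐ w ∂μ, |g w| ≤ |h w|) : g ∈ multipliers X Y := by
  refine mem_multipliers_of_forall_mul_mem fun f =>
    Y.mem_of_ae_abs_le (mulOperator ⟨h, hh⟩ f).2 ?_
  filter_upwards [hgh, AEEqFun.coeFn_mul g f.toAEEqFun, coeFn_mulOperator ⟨h, hh⟩ f]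
    with w h1 h2 h3
  rw [h2, Pi.mul_apply, show (mulOperator ⟨h, hh⟩ f).1 w = _ from h3, abs_mul, abs_mul]
  exact mul_le_mul_of_nonneg_right h1 (abs_nonneg _)

theorem multiplierNorm_mono {X Y : BanachFunctionSpace μ} {g h : multipliers X Y}
    (hgh : ∀ᵐ w ∂μ, |(g : Ω →ₘ[μ] ℝ) w| ≤ |(h : Ω →ₘ[μ] ℝ) w|) :
    multiplierNorm g ≤ multiplierNorm h := by
  refine (mulOperator g).opNorm_le_bound (norm_nonneg _) fun f =>
    le_trans (Elem.norm_le_norm ?_) ((mulOperator h).le_opNorm f)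
  filter_upwards [hgh, coeFn_mulOperator g f, coeFn_mulOperator h f] with w h1 h2 h3
  rw [h2, h3, abs_mul, abs_mul]
  exact mul_le_mul_of_nonneg_right h1 (abs_nonneg _)

theorem multiplierNorm_smul {X Y : BanachFunctionSpace μ} (c : ℝ) (g : multipliers X Y) :
    multiplierNorm (c • g) = |c| * multiplierNorm g := by
  have h : mulOperator (c • g) = c • mulOperator g := by
    ext1 f
    apply Elem.toAEEqFun_injective
    apply AEEqFun.ext
    filter_upwards [coeFn_mulOperator (c • g) f, coeFn_mulOperator g f,
      Elem.coeFn_smul c (mulOperator g f), AEEqFun.coeFn_smul c (g : Ω →ₘ[μ] ℝ)] with w h1 h2 h3 h4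
    rw [h1, _root_.smul_apply, h3, h2, ← mul_assoc]
    exact congrArg (· * _) h4
  rw [multiplierNorm, h, norm_smul, Real.norm_eq_abs, multiplierNorm]

theorem one_mem_multipliers {X Y : BanachFunctionSpace μ} (hXY : X.toSubmodule ≤ Y.toSubmodule) :
    (1 : Ω →ₘ[μ] ℝ) ∈ multipliers X Y :=
  mem_multipliers_of_forall_mul_mem fun f => by
    rw [one_mul]
    exact hXY f.2

/-- The degenerate case in which constants cannot realize a prescribed norm: then `X` is trivial, so
no other norm than zero occurs. -/
theorem multiplierNorm_eq_zero_of_one {X Y : BanachFunctionSpace μ}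
    (h1 : (1 : Ω →ₘ[μ] ℝ) ∈ multipliers X Y)
    (h : multiplierNorm (⟨1, h1⟩ : multipliers X Y) = 0) (g : multipliers X Y) :
    multiplierNorm g = 0 := by
  have hX : ∀ f : X, f = 0 := fun f => by
    have hf : mulOperator (⟨1, h1⟩ : multipliers X Y) f = 0 := by
      rw [norm_eq_zero.1 h, _root_.zero_apply]
    have := mulOperator_apply (⟨1, h1⟩ : multipliers X Y) f
    rw [hf] at this
    apply Elem.toAEEqFun_injective
    rw [one_mul] at this
    exact this.symm
  rw [multiplierNorm, norm_eq_zero]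
  ext1 f
  rw [hX f, _root_.map_zero, _root_.map_zero]

end BanachFunctionSpace

/-! ### Tail infima: an increasing sequence with the same limit -/

theorem bddBelow_range_of_nonneg {a : ℕ → ℝ} (ha : ∀ n, 0 ≤ a n) : BddBelow (range a) :=
  ⟨0, by rintro _ ⟨n, rfl⟩; exact ha n⟩

theorem monotone_iInf_tail {a : ℕ → ℝ} (ha : ∀ n, 0 ≤ a n) :
    Monotone fun n => ⨅ k, a (n + k) := by
  refine monotone_nat_of_le_succ fun n => le_ciInf fun k => ?_
  rw [add_assoc]
  exact ciInf_le (bddBelow_range_of_nonneg fun k => ha (n + k)) (1 + k)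

theorem tendsto_iInf_tail {a : ℕ → ℝ} (ha : ∀ n, 0 ≤ a n) {l : ℝ}
    (h : Tendsto a atTop (𝓝 l)) : Tendsto (fun n => ⨅ k, a (n + k)) atTop (𝓝 l) := by
  refine tendsto_order.2 ⟨fun b hb => ?_, fun b hb => ?_⟩
  · obtain ⟨c, hbc, hcl⟩ := exists_between hb
    obtain ⟨N, hN⟩ := eventually_atTop.1 (h.eventually (eventually_gt_nhds hcl))
    filter_upwards [eventually_ge_atTop N] with n hn
    exact hbc.trans_le (le_ciInf fun k => (hN (n + k) (by omega)).le)
  · filter_upwards [h.eventually (eventually_lt_nhds hb)] with n hn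
    exact (ciInf_le (bddBelow_range_of_nonneg fun k => ha (n + k)) 0).trans_lt hn

/-! ### Density and nontriviality in `LipZero` -/

namespace LipZero

theorem continuous (φ : LipZero) : Continuous φ :=
  (LipschitzWith.of_dist_le_mul (K := ⟨φ.lip, φ.lip_nonneg⟩) fun x y => by
    rw [Real.dist_eq, Real.dist_eq]
    exact φ.abs_sub_le x y).continuous

theorem eq_of_eq_rat {φ ψ : LipZero} (h : ∀ q : ℚ, φ q = ψ q) : φ = ψ := by
  ext x
  exact congrFun (Rat.denseRange_cast.equalizer φ.continuous ψ.continuous (funext h)) x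

instance : Nontrivial LipZero :=
  ⟨⟨id, rfl, 1, fun x y => by simp⟩, 0, fun h =>
    one_ne_zero (α := ℝ) (congrArg (fun φ : LipZero => φ 1) h)⟩

end LipZero

namespace BanachFunctionSpace

variable {Ω : Type*} [MeasurableSpace Ω] {μ : Measure Ω}

/-! ### Limits and truncations in the Köthe–Bochner space -/

section KotheBochner

variable {X Y : BanachFunctionSpace μ} {E : Type*} [NormedAddCommGroup E] {Φ Ψ : Ω → E}

theorem ae_abs_mk_norm_le (hΦ : AEStronglyMeasurable Φ μ) (hΨ : AEStronglyMeasurable Ψ μ)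
    (h : ∀ᵐ w ∂μ, ‖Ψ w‖ ≤ ‖Φ w‖) :
    ∀ᵐ w ∂μ, |AEEqFun.mk (fun w => ‖Ψ w‖) hΨ.norm w| ≤ |AEEqFun.mk (fun w => ‖Φ w‖) hΦ.norm w| := by
  filter_upwards [h, AEEqFun.coeFn_mk _ hΨ.norm, AEEqFun.coeFn_mk _ hΦ.norm] with w h1 h2 h3
  rwa [h2, h3, abs_norm, abs_norm]

theorem MemKotheBochner.of_ae_norm_le (hΦ : MemKotheBochner X Y Φ)
    (hΨ : AEStronglyMeasurable Ψ μ) (h : ∀ᵐ w ∂μ, ‖Ψ w‖ ≤ ‖Φ w‖) : MemKotheBochner X Y Ψ :=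
  ⟨hΨ, mem_multipliers_of_ae_abs_le hΦ.2 (ae_abs_mk_norm_le hΦ.1 hΨ h)⟩

theorem kotheBochnerNorm_mono (hΦ : MemKotheBochner X Y Φ) (hΨ : MemKotheBochner X Y Ψ)
    (h : ∀ᵐ w ∂μ, ‖Ψ w‖ ≤ ‖Φ w‖) : kotheBochnerNorm hΨ ≤ kotheBochnerNorm hΦ :=
  multiplierNorm_mono (ae_abs_mk_norm_le hΦ.1 hΨ.1 h)

theorem kotheBochnerNorm_nonneg (hΦ : MemKotheBochner X Y Φ) : 0 ≤ kotheBochnerNorm hΦ :=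
  norm_nonneg (mulOperator _)

theorem mk_norm_const (x : E) :
    AEEqFun.mk (fun _ : Ω => ‖x‖) aestronglyMeasurable_const = ‖x‖ • (1 : Ω →ₘ[μ] ℝ) := by
  apply AEEqFun.ext
  filter_upwards [AEEqFun.coeFn_mk (μ := μ) (fun _ : Ω => ‖x‖) aestronglyMeasurable_const,
    AEEqFun.coeFn_smul ‖x‖ (1 : Ω →ₘ[μ] ℝ), AEEqFun.coeFn_one (μ := μ) (β := ℝ)] with w h1 h2 h3
  rw [h1, h2, Pi.smul_apply, h3, Pi.one_apply, smul_eq_mul, mul_one]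

theorem memKotheBochner_const (hXY : X.toSubmodule ≤ Y.toSubmodule) (x : E) :
    MemKotheBochner X Y fun _ : Ω => x := by
  refine ⟨aestronglyMeasurable_const, ?_⟩
  rw [mk_norm_const x]
  exact Submodule.smul_mem _ _ (one_mem_multipliers hXY)

theorem kotheBochnerNorm_const (hXY : X.toSubmodule ≤ Y.toSubmodule) {x : E}
    (hx : MemKotheBochner X Y fun _ : Ω => x) :
    kotheBochnerNorm hx =
      ‖x‖ * multiplierNorm (⟨1, one_mem_multipliers hXY⟩ : multipliers X Y) := by
  rw [← abs_norm x, ← multiplierNorm_smul, kotheBochnerNorm]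
  exact congrArg multiplierNorm (Subtype.ext (mk_norm_const x))

/-- If `Y(μ)` has the Fatou property, a.e. limits of sequences that are bounded in `𝓜(X,Y)(μ, E)`
belong to `𝓜(X,Y)(μ, E)`. -/
theorem MemKotheBochner.of_tendsto (hY : Y.HasFatouProperty) (hΦ : AEStronglyMeasurable Φ μ)
    {Φs : ℕ → Ω → E} (h : ∀ n, MemKotheBochner X Y (Φs n)) {C : ℝ}
    (hC : ∀ n, kotheBochnerNorm (h n) ≤ C)
    (hlim : ∀ᵐ w ∂μ, Tendsto (fun n => Φs n w) atTop (𝓝 (Φ w))) : MemKotheBochner X Y Φ := by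
  refine ⟨hΦ, mem_multipliers_of_forall_mul_mem fun f => ?_⟩
  let a : ℕ → Ω → ℝ := fun n w => (⨅ k, ‖Φs (n + k) w‖) * |f.toAEEqFun w|
  have hf : AEStronglyMeasurable (fun w => |f.toAEEqFun w|) μ :=
    f.toAEEqFun.aestronglyMeasurable.norm
  have ham : ∀ n, AEStronglyMeasurable (a n) μ := fun n =>
    (AEMeasurable.iInf fun k => (h (n + k)).1.norm.aemeasurable).aestronglyMeasurable.mul hf
  let g : ℕ → multipliers X Y := fun n => ⟨AEEqFun.mk (fun w => ‖Φs n w‖) (h n).1.norm, (h n).2⟩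
  have hle : ∀ n, ∀ᵐ w ∂μ,
      |AEEqFun.mk (a n) (ham n) w| ≤ |(mulOperator (g n) f).toAEEqFun w| := fun n => by
    filter_upwards [AEEqFun.coeFn_mk _ (ham n), coeFn_mulOperator (g n) f,
      AEEqFun.coeFn_mk _ (h n).1.norm] with w h1 h2 h3
    rw [h1, h2, abs_mul, abs_mul, abs_abs,
      show (g n : Ω →ₘ[μ] ℝ) w = ‖Φs n w‖ from h3, abs_norm,
      abs_of_nonneg (Real.iInf_nonneg fun k => norm_nonneg _)]
    exact mul_le_mul_of_nonneg_right
      (ciInf_le (bddBelow_range_of_nonneg fun k => norm_nonneg (Φs (n + k) w)) 0) (abs_nonneg _)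
  let v : ℕ → Y := fun n =>
    ⟨AEEqFun.mk (a n) (ham n), Y.mem_of_ae_abs_le (mulOperator (g n) f).2 (hle n)⟩
  have hgf : AEStronglyMeasurable (fun w => ‖Φ w‖ * |f.toAEEqFun w|) μ := hΦ.norm.mul hf
  have hmem : AEEqFun.mk _ hgf ∈ Y.toSubmodule := by
    refine hY v _ ?_ ⟨C * ‖f‖, fun n => ?_⟩ ?_
    · intro m n hmn
      refine AEEqFun.coeFn_le.1 ?_
      filter_upwards [AEEqFun.coeFn_mk _ (ham m), AEEqFun.coeFn_mk _ (ham n)] with w h1 h2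
      refine (h1.trans_le ?_).trans h2.ge
      exact mul_le_mul_of_nonneg_right
        (monotone_iInf_tail (fun n => norm_nonneg (Φs n w)) hmn) (abs_nonneg _)
    · exact (Elem.norm_le_norm (hle n)).trans (((mulOperator (g n)).le_opNorm f).trans
        (mul_le_mul_of_nonneg_right (hC n) (norm_nonneg f)))
    · filter_upwards [hlim, AEEqFun.coeFn_mk _ hgf,
        ae_all_iff.2 fun n => AEEqFun.coeFn_mk _ (ham n)] with w h1 h2 h3
      rw [h2]
      refine Tendsto.congr (fun n => (h3 n).symm) ?_
      exact (tendsto_iInf_tail (fun n => norm_nonneg (Φs n w)) h1.norm).mul_const _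
  refine Y.mem_of_ae_abs_le hmem ?_
  filter_upwards [AEEqFun.coeFn_mk _ hgf, AEEqFun.coeFn_mk _ hΦ.norm,
    AEEqFun.coeFn_mul (AEEqFun.mk (fun w => ‖Φ w‖) hΦ.norm) f.toAEEqFun] with w h1 h2 h3
  rw [h1, h3, Pi.mul_apply, h2, abs_mul, abs_mul, abs_abs]

/-- The truncations of `Φ` at the levels `n`. -/
theorem exists_memLp_top_tendsto (hΦ : AEStronglyMeasurable Φ μ) :
    ∃ Φs : ℕ → Ω → E, (∀ n, MemLp (Φs n) ∞ μ) ∧ (∀ n w, ‖Φs n w‖ ≤ ‖Φ w‖) ∧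
      ∀ᵐ w ∂μ, Tendsto (fun n => Φs n w) atTop (𝓝 (Φ w)) := by
  -- The levels are those of the strongly measurable representative, which makes the sets
  -- measurable.
  let S : ℕ → Set Ω := fun n => {w | ‖hΦ.mk Φ w‖ ≤ n}
  have hS : ∀ n, MeasurableSet (S n) := fun n =>
    hΦ.stronglyMeasurable_mk.norm.measurable measurableSet_Iic
  refine ⟨fun n => (S n).indicator Φ, fun n => ?_, fun n w => norm_indicator_le_norm_self _ _, ?_⟩
  · refine memLp_top_of_bound (hΦ.indicator (hS n)) n ?_
    filter_upwards [hΦ.ae_eq_mk] with w hw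
    by_cases h : w ∈ S n
    · rw [indicator_of_mem h, hw]
      exact h
    · rw [indicator_of_notMem h, norm_zero]
      exact n.cast_nonneg
  · filter_upwards with w
    obtain ⟨N, hN⟩ := exists_nat_ge ‖hΦ.mk Φ w‖
    refine tendsto_const_nhds.congr' ?_
    filter_upwards [eventually_ge_atTop N] with n hn
    exact (indicator_of_mem (s := S n) (hN.trans (Nat.cast_le.2 hn)) Φ).symm

/-- Every `Φ` in `𝓜(X,Y)(μ, E)` is an a.e. limit of essentially bounded functions the supremum of
whose norms is the norm of `Φ`. The norm of `Y(μ)` need not be order continuous from below, so the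
norms of the truncations of `Φ` need not approach the norm of `Φ`; the sequence therefore starts
with a constant function of the right norm. -/
theorem MemKotheBochner.exists_memLp_top_isLUB [NormedSpace ℝ E] [Nontrivial E]
    (hXY : X.toSubmodule ≤ Y.toSubmodule) (hΦ : MemKotheBochner X Y Φ) :
    ∃ Φs : ℕ → Ω → E, (∀ n, MemLp (Φs n) ∞ μ) ∧
      (∃ h : ∀ n, MemKotheBochner X Y (Φs n),
        IsLUB (range fun n => kotheBochnerNorm (h n)) (kotheBochnerNorm hΦ)) ∧
      ∀ᵐ w ∂μ, Tendsto (fun n => Φs n w) atTop (𝓝 (Φ w)) := by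
  obtain ⟨Ψs, hΨ, hle, hlim⟩ := exists_memLp_top_tendsto hΦ.1
  obtain ⟨x, hx⟩ : ∃ x : E, ‖x‖ * multiplierNorm
      (⟨1, one_mem_multipliers hXY⟩ : multipliers X Y) = kotheBochnerNorm hΦ := by
    by_cases h : multiplierNorm (⟨1, one_mem_multipliers hXY⟩ : multipliers X Y) = 0
    · exact ⟨0, by rw [norm_zero, zero_mul]; exact (multiplierNorm_eq_zero_of_one _ h _).symm⟩
    · obtain ⟨x, hx⟩ := exists_norm_eq E (div_nonneg (kotheBochnerNorm_nonneg hΦ)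
        (norm_nonneg (mulOperator (⟨1, one_mem_multipliers hXY⟩ : multipliers X Y))))
      exact ⟨x, by rw [hx]; exact div_mul_cancel₀ _ h⟩
  -- Index `0` attains the supremum; the shift of the truncations by one does not change the limit.
  let Φs : ℕ → Ω → E := fun n => Nat.casesOn n (fun _ => x) Ψs
  have h : ∀ n, MemKotheBochner X Y (Φs n) := by
    rintro (_ | n)
    · exact memKotheBochner_const hXY x
    · exact hΦ.of_ae_norm_le (hΨ n).1 (.of_forall (hle n))
  have h0 : kotheBochnerNorm (h 0) = kotheBochnerNorm hΦ :=
    (kotheBochnerNorm_const hXY (h 0)).trans hx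
  refine ⟨Φs, ?_, ⟨h, ?_, fun b hb => h0.symm.trans_le (hb ⟨0, rfl⟩)⟩, ?_⟩
  · rintro (_ | n)
    · exact memLp_top_const x
    · exact hΨ n
  · rintro _ ⟨_ | n, rfl⟩
    · exact h0.le
    · exact kotheBochnerNorm_mono hΦ (h (n + 1)) (.of_forall (hle n))
  · filter_upwards [hlim] with w hw
    exact (tendsto_add_atTop_iff_nat (f := fun n => Φs n w) 1).1 hw

end KotheBochner

/-- The function `Φ` in `T = T_Φ` is unique up to null sets. -/
theorem IsSuperposition.ae_eq {X Y : BanachFunctionSpace μ} {T : X → Y} {Φ Ψ : Ω → LipZero}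
    (hΦ : IsSuperposition T Φ) (hΨ : IsSuperposition T Ψ) : Φ =ᵐ[μ] Ψ := by
  let e : X := ⟨1, X.one_mem⟩
  -- Testing on rational constants keeps the exceptional null sets countable in number; continuity
  -- then gives all real arguments.
  have h : ∀ q : ℚ, ∀ᵐ w ∂μ, Φ w q = Ψ w q := fun q => by
    filter_upwards [hΦ ((q : ℝ) • e), hΨ ((q : ℝ) • e), Elem.coeFn_smul (q : ℝ) e,
      AEEqFun.coeFn_one (μ := μ) (β := ℝ)] with w h1 h2 h3 h4
    have h5 : ((q : ℝ) • e).toAEEqFun w = q := by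
      rw [h3, show e.toAEEqFun w = 1 from h4, mul_one]
    rw [h5] at h1 h2
    exact h1.symm.trans h2
  filter_upwards [ae_all_iff.2 h] with w hw
  exact LipZero.eq_of_eq_rat hw

end BanachFunctionSpace

theorem mainTheorem1 {Ω : Type*} [MeasurableSpace Ω] (μ : MeasureTheory.Measure Ω)
    [MeasureTheory.IsFiniteMeasure μ] (X Y : BanachFunctionSpace μ) 
    (hXY : X.toSubmodule ≤ Y.toSubmodule)
    (hY : Y.HasFatouProperty) (T : X → Y) :
    (BanachFunctionSpace.StronglyLatticeLipschitz T ↔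
      ∃ Φ : Ω → LipZero, AEStronglyMeasurable Φ μ ∧ BanachFunctionSpace.IsSuperposition T Φ ∧
        ∃ Φs : ℕ → Ω → LipZero,
          (∀ n, MemLp (Φs n) ∞ μ) ∧
          (∃ (h : ∀ n, BanachFunctionSpace.MemKotheBochner X Y (Φs n)) (C : ℝ),
            ∀ n, BanachFunctionSpace.kotheBochnerNorm (h n) ≤ C) ∧
          ∀ᵐ w ∂μ, Tendsto (fun n => Φs n w) atTop (𝓝 (Φ w))) ∧
    (BanachFunctionSpace.StronglyLatticeLipschitz T →
      ∀ Φ : Ω → LipZero, AEStronglyMeasurable Φ μ → BanachFunctionSpace.IsSuperposition T Φ →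
        ∃ (hΦ : BanachFunctionSpace.MemKotheBochner X Y Φ) (Φs : ℕ → Ω → LipZero),
          (∀ n, MemLp (Φs n) ∞ μ) ∧
          (∃ h : ∀ n, BanachFunctionSpace.MemKotheBochner X Y (Φs n),
            IsLUB (range fun n => BanachFunctionSpace.kotheBochnerNorm (h n))
              (BanachFunctionSpace.kotheBochnerNorm hΦ)) ∧
          ∀ᵐ w ∂μ, Tendsto (fun n => Φs n w) atTop (𝓝 (Φ w))) := by
  have main : BanachFunctionSpace.StronglyLatticeLipschitz T →
      ∀ Φ : Ω → LipZero, AEStronglyMeasurable Φ μ → BanachFunctionSpace.IsSuperposition T Φ →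
        BanachFunctionSpace.MemKotheBochner X Y Φ := by
    rintro ⟨Ψ, hΨ, hTΨ⟩ Φ hΦ hTΦ
    refine hΨ.of_ae_norm_le hΦ ?_
    filter_upwards [hTΦ.ae_eq hTΨ] with w hw
    rw [hw]
  refine ⟨⟨?_, ?_⟩, fun hT Φ hΦ hTΦ =>
    ⟨main hT Φ hΦ hTΦ, (main hT Φ hΦ hTΦ).exists_memLp_top_isLUB hXY⟩⟩
  · rintro ⟨Φ, hΦ, hTΦ⟩
    obtain ⟨Φs, hL, ⟨h, hlub⟩, hlim⟩ := hΦ.exists_memLp_top_isLUB hXY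
    exact ⟨Φ, hΦ.1, hTΦ, Φs, hL, ⟨h, _, fun n => hlub.1 ⟨n, rfl⟩⟩, hlim⟩
  · rintro ⟨Φ, hΦ, hTΦ, Φs, -, ⟨h, C, hC⟩, hlim⟩
    exact ⟨Φ, .of_tendsto hY hΦ h hC hlim, hTΦ⟩
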